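/- All groups are finite. A \emph{cover} of a group $G$ is a set of proper subgroups of $G$ whose union is $G$; it is \emph{irredundant} if no proper subset of it is a cover of $G$. Let $\beta(G)$ be the number of distinct irredundant covers of $G$ (so $\beta(G)=0$ if $G$ is cyclic). Let $\mathbb{Z}_n$ denote the cyclic group of order $n$, and let $K\rtimes H$ denote a semidirect product with normal factor $K$, for some (possibly trivial) action of $H$ on $K$. (1) Suppose that $G$ is nilpotent and $\beta(G)=2$. Then there are a prime $p$, a Sylow $p$-subgroup $P$ of $G$ and a positive integer $m$ with $(|P|,m)=1$ such that $G\cong P\times\mathbb{Z}_m$, $\beta(P)=2$, $P$ has a maximal subgroup that is cyclic, and either $p$ is odd and $P\cong\mathbb{Z}_{p^2}\rtimes\mathbb{Z}_p$, or $p=2$ and $P\cong\mathbb{Z}_4\times\mathbb{Z}_2$. (2) Let $p$ be a prime and $P$ a $p$-group. Then $\beta(P)=2$ if and only if either $p$ is odd and $P\cong\mathbb{Z}_{p^2}\rtimes\mathbb{Z}_p$, or $p=2$ and $P\cong\mathbb{Z}_4\times\mathbb{Z}_2$. -/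

import Mathlib

/-- A set of subgroups of `G` is a cover of `G` if all its members are proper subgroups and their
union is all of `G`. -/
def IsSubgroupCover (G : Type*) [Group G] (C : Set (Subgroup G)) : Prop :=
  (∀ H ∈ C, H ≠ ⊤) ∧ (⋃ H ∈ C, (H : Set G)) = Set.univ

/-- A cover is irredundant if no member can be removed from it. -/
def IsIrredundantCover (G : Type*) [Group G] (C : Set (Subgroup G)) : Prop :=
  IsSubgroupCover G C ∧ ∀ H ∈ C, ¬ IsSubgroupCover G (C \ {H})

/-- `coverBeta G` is the number of distinct irredundant covers of `G` (used for finite `G`). -/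
noncomputable def coverBeta (G : Type*) [Group G] : ℕ :=
  Set.ncard {C : Set (Subgroup G) | IsIrredundantCover G C}

/-- For a prime `p`: either `p` is odd and `P` is a semidirect product of the cyclic groups of
orders `p ^ 2` (normal) and `p`, for some action (possibly trivial), or `p = 2` and `P` is the
direct product of the cyclic groups of orders `4` and `2`. -/
def IsListedPGroup (p : ℕ) (P : Type*) [Group P] : Prop :=
  (Odd p ∧ ∃ φ : Multiplicative (ZMod p) →* MulAut (Multiplicative (ZMod (p ^ 2))),
    Nonempty (P ≃* Multiplicative (ZMod (p ^ 2)) ⋊[φ] Multiplicative (ZMod p))) ∨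
  (p = 2 ∧ Nonempty (P ≃* Multiplicative (ZMod 4) × Multiplicative (ZMod 2)))

/-! The maximal cyclic subgroups of a noncyclic `G` form an irredundant cover. Every intermediate
subgroup `H` (proper, noncyclic, containing a maximal cyclic subgroup) gives another, `coverWith H`,
and different `H` give different covers. Hence `coverBeta G = 2` exactly when there is one
intermediate subgroup (`coverBeta_eq_two_iff`).

In a `p`-group, uniqueness makes `H` a maximal subgroup and makes every `x ∉ H` generate a maximal
subgroup. Correcting an element of `H` by a central power of `x` yields `z ∈ H` of order `p` outside
`⟨x⟩`. Then `⟨z⟩` is maximal cyclic, which forces `|H| = p ^ 2` and `|P| = p ^ 3`, so `P = ⟨x⟩ ⋊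
⟨z⟩`. Conversely, in the listed groups the elements with `g ^ p = 1` form the only intermediate
subgroup.

A nilpotent group splits off a noncyclic Sylow subgroup; uniqueness makes the coprime complement
cyclic and passes to the Sylow factor. -/

/-! ### Irredundant covers and intermediate subgroups -/

theorem isSubgroupCover_iff {G : Type*} [Group G] {C : Set (Subgroup G)} :
    IsSubgroupCover G C ↔ (∀ H ∈ C, H ≠ ⊤) ∧ ∀ x : G, ∃ H ∈ C, x ∈ H := by
  simp [IsSubgroupCover, Set.eq_univ_iff_forall]

theorem IsIrredundantCover.eq_of_subset {G : Type*} [Group G] {C D : Set (Subgroup G)}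
    (hC : IsIrredundantCover G C) (hD : IsSubgroupCover G D) (h : D ⊆ C) : D = C := by
  refine h.antisymm fun H hH => ?_
  by_contra hHD
  refine hC.2 H hH ?_
  rw [isSubgroupCover_iff] at hD ⊢
  refine ⟨fun K hK => (isSubgroupCover_iff.1 hC.1).1 K hK.1, fun x => ?_⟩
  obtain ⟨K, hK, hx⟩ := hD.2 x
  exact ⟨K, ⟨h hK, fun e => hHD (e ▸ hK)⟩, hx⟩

theorem IsSubgroupCover.isIrredundantCover {G : Type*} [Group G] {C : Set (Subgroup G)}
    (hC : IsSubgroupCover G C) (h : ∀ H ∈ C, ∃ x : G, ∀ K ∈ C, x ∈ K → K = H) :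
    IsIrredundantCover G C := by
  refine ⟨hC, fun H hH hcov => ?_⟩
  obtain ⟨x, hx⟩ := h H hH
  obtain ⟨K, hK, hxK⟩ := (isSubgroupCover_iff.1 hcov).2 x
  exact hK.2 (hx K hK.1 hxK)

/-- A subgroup that is maximal among the cyclic subgroups. -/
def IsMaxCyclic {G : Type*} [Group G] (C : Subgroup G) : Prop :=
  Maximal (fun D : Subgroup G => IsCyclic D) C

/-- A proper noncyclic subgroup that contains a maximal cyclic subgroup. -/
def IsIntermediate {G : Type*} [Group G] (H : Subgroup G) : Prop :=
  H ≠ ⊤ ∧ ¬ IsCyclic H ∧ ∃ C : Subgroup G, IsMaxCyclic C ∧ C ≤ H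

theorem isCyclic_of_le {G : Type*} [Group G] {H K : Subgroup G} (h : H ≤ K) (hK : IsCyclic K) :
    IsCyclic H :=
  isCyclic_of_injective _ (Subgroup.inclusion_injective h)

theorem isCyclic_zpowers {G : Type*} [Group G] (x : G) : IsCyclic (Subgroup.zpowers x) :=
  inferInstance

theorem IsMaxCyclic.exists_zpowers_eq {G : Type*} [Group G] {C : Subgroup G}
    (hC : IsMaxCyclic C) : ∃ x : G, Subgroup.zpowers x = C :=
  Subgroup.isCyclic_iff_exists_zpowers_eq_top C |>.1 hC.1

theorem IsMaxCyclic.eq_of_le {G : Type*} [Group G] {C D : Subgroup G} (hC : IsMaxCyclic C)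
    (hD : IsCyclic D) (h : C ≤ D) : C = D :=
  le_antisymm h (hC.2 hD h)

theorem exists_isMaxCyclic_ge {G : Type*} [Group G] [Finite G] {D : Subgroup G}
    (hD : IsCyclic D) : ∃ C : Subgroup G, IsMaxCyclic C ∧ D ≤ C := by
  obtain ⟨C, h, hC⟩ := Finite.exists_le_maximal (p := fun D : Subgroup G => IsCyclic D) hD
  exact ⟨C, hC, h⟩

theorem exists_isMaxCyclic_mem {G : Type*} [Group G] [Finite G] (x : G) :
    ∃ C : Subgroup G, IsMaxCyclic C ∧ x ∈ C := by
  obtain ⟨C, hC, h⟩ := exists_isMaxCyclic_ge (isCyclic_zpowers x)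
  exact ⟨C, hC, h (Subgroup.mem_zpowers x)⟩

theorem isCyclic_top_iff {G : Type*} [Group G] : IsCyclic (⊤ : Subgroup G) ↔ IsCyclic G :=
  Subgroup.topEquiv.isCyclic

theorem ne_top_of_isCyclic {G : Type*} [Group G] (hG : ¬ IsCyclic G) {C : Subgroup G}
    (hC : IsCyclic C) : C ≠ ⊤ := by
  rintro rfl
  exact hG (isCyclic_top_iff.1 hC)

/-- The cover by the subgroup `H` and the maximal cyclic subgroups not contained in `H`. -/
def coverWith {G : Type*} [Group G] (H : Subgroup G) : Set (Subgroup G) :=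
  insert H {C | IsMaxCyclic C ∧ ¬ C ≤ H}

theorem isIrredundantCover_isMaxCyclic {G : Type*} [Group G] [Finite G] (hG : ¬ IsCyclic G) :
    IsIrredundantCover G {C | IsMaxCyclic C} := by
  refine IsSubgroupCover.isIrredundantCover (isSubgroupCover_iff.2
    ⟨fun C hC => ne_top_of_isCyclic hG hC.1, fun x => exists_isMaxCyclic_mem x⟩) ?_
  intro C hC
  obtain ⟨x, rfl⟩ := hC.exists_zpowers_eq
  exact ⟨x, fun K hK hx => (hC.eq_of_le hK.1 (by simpa using hx)).symm⟩

/-- Each member has a private element: for `H`, a generator of a maximal cyclic subgroup inside `H`;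
for the others, their own generators. -/
theorem IsIntermediate.isIrredundantCover_coverWith {G : Type*} [Group G] [Finite G]
    {H : Subgroup G} (hH : IsIntermediate H) : IsIrredundantCover G (coverWith H) := by
  have hG : ¬ IsCyclic G := fun h => hH.2.1 inferInstance
  refine IsSubgroupCover.isIrredundantCover (isSubgroupCover_iff.2 ⟨?_, fun x => ?_⟩) ?_
  · rintro K (rfl | hK)
    · exact hH.1
    · exact ne_top_of_isCyclic hG hK.1.1
  · obtain ⟨C, hC, hx⟩ := exists_isMaxCyclic_mem x
    by_cases h : C ≤ H
    · exact ⟨H, Or.inl rfl, h hx⟩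
    · exact ⟨C, Or.inr ⟨hC, h⟩, hx⟩
  · rintro K (rfl | hK)
    · obtain ⟨C, hC, hCK⟩ := hH.2.2
      obtain ⟨x, rfl⟩ := hC.exists_zpowers_eq
      refine ⟨x, ?_⟩
      rintro L (rfl | hL) hx
      · rfl
      · exact absurd hCK (hC.eq_of_le hL.1.1 (by simpa using hx) ▸ hL.2)
    · obtain ⟨hK, hKH⟩ := hK
      obtain ⟨x, rfl⟩ := hK.exists_zpowers_eq
      refine ⟨x, ?_⟩
      rintro L (rfl | hL) hx
      · exact absurd (by simpa using hx) hKH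
      · exact (hK.eq_of_le hL.1.1 (by simpa using hx)).symm

theorem IsSubgroupCover.exists_ge {G : Type*} [Group G] {𝒞 : Set (Subgroup G)}
    (h𝒞 : IsSubgroupCover G 𝒞) {C : Subgroup G} (hC : IsCyclic C) : ∃ K ∈ 𝒞, C ≤ K := by
  obtain ⟨x, rfl⟩ := Subgroup.isCyclic_iff_exists_zpowers_eq_top C |>.1 hC
  obtain ⟨K, hK, hx⟩ := (isSubgroupCover_iff.1 h𝒞).2 x
  exact ⟨K, hK, by simpa using hx⟩

theorem IsIrredundantCover.not_isCyclic {G : Type*} [Group G] {𝒞 : Set (Subgroup G)}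
    (h𝒞 : IsIrredundantCover G 𝒞) : ¬ IsCyclic G := by
  intro h
  obtain ⟨K, hK, hle⟩ := h𝒞.1.exists_ge (isCyclic_top_iff.2 h)
  exact (isSubgroupCover_iff.1 h𝒞.1).1 K hK (top_le_iff.1 hle)

/-- A maximal cyclic subgroup lies in some member, which must be cyclic, hence equal to it. So the
cover contains the maximal cyclic one, and irredundancy gives equality. -/
theorem IsIrredundantCover.eq_isMaxCyclic {G : Type*} [Group G] [Finite G]
    {𝒞 : Set (Subgroup G)} (h𝒞 : IsIrredundantCover G 𝒞) (h : ∀ H ∈ 𝒞, ¬ IsIntermediate H) :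
    𝒞 = {C | IsMaxCyclic C} := by
  refine (h𝒞.eq_of_subset (isIrredundantCover_isMaxCyclic h𝒞.not_isCyclic).1 ?_).symm
  intro C hC
  obtain ⟨K, hK, hle⟩ := h𝒞.1.exists_ge hC.1
  have hKc : IsCyclic K := by
    by_contra hn
    exact h K hK ⟨(isSubgroupCover_iff.1 h𝒞.1).1 K hK, hn, C, hC, hle⟩
  exact hC.eq_of_le hKc hle ▸ hK

theorem IsIrredundantCover.eq_coverWith {G : Type*} [Group G] [Finite G]
    {𝒞 : Set (Subgroup G)} (h𝒞 : IsIrredundantCover G 𝒞) {H : Subgroup G} (hH : IsIntermediate H)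
    (hmem : H ∈ 𝒞) (h : ∀ K, IsIntermediate K → K = H) : 𝒞 = coverWith H := by
  refine (h𝒞.eq_of_subset hH.isIrredundantCover_coverWith.1 ?_).symm
  rintro C (rfl | ⟨hC, hCH⟩)
  · exact hmem
  obtain ⟨K, hK, hle⟩ := h𝒞.1.exists_ge hC.1
  have hKc : IsCyclic K := by
    by_contra hn
    exact hCH (h K ⟨(isSubgroupCover_iff.1 h𝒞.1).1 K hK, hn, C, hC, hle⟩ ▸ hle)
  exact hC.eq_of_le hKc hle ▸ hK

theorem coverWith_ne_isMaxCyclic {G : Type*} [Group G] {H : Subgroup G} (hH : IsIntermediate H) :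
    coverWith H ≠ {C | IsMaxCyclic C} := by
  intro h
  have : H ∈ {C : Subgroup G | IsMaxCyclic C} := h ▸ Or.inl rfl
  exact hH.2.1 this.1

theorem coverWith_injOn {G : Type*} [Group G] {H K : Subgroup G} (hH : IsIntermediate H)
    (h : coverWith H = coverWith K) : H = K := by
  have : H ∈ coverWith K := h ▸ Or.inl rfl
  rcases this with h | h
  · exact h
  · exact absurd h.1.1 hH.2.1

theorem coverBeta_eq_two_iff {G : Type*} [Group G] [Finite G] :
    coverBeta G = 2 ↔ ∃! H : Subgroup G, IsIntermediate H := by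
  rw [coverBeta, Set.ncard_eq_two]
  constructor
  · rintro ⟨𝒜, ℬ, hne, hset⟩
    have hmem : ∀ 𝒞, IsIrredundantCover G 𝒞 ↔ 𝒞 = 𝒜 ∨ 𝒞 = ℬ := fun 𝒞 => by
      simpa using Set.ext_iff.1 hset 𝒞
    have hG := ((hmem 𝒜).2 (Or.inl rfl)).not_isCyclic
    have h0 := (hmem _).1 (isIrredundantCover_isMaxCyclic hG)
    have hex : ∃ H : Subgroup G, IsIntermediate H := by
      by_contra! hno
      exact hne ((((hmem 𝒜).2 (Or.inl rfl)).eq_isMaxCyclic fun H _ => hno H).trans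
        (((hmem ℬ).2 (Or.inr rfl)).eq_isMaxCyclic fun H _ => hno H).symm)
    obtain ⟨H, hH⟩ := hex
    refine ⟨H, hH, fun K hK => coverWith_injOn hK ?_⟩
    have h1 := (hmem _).1 hH.isIrredundantCover_coverWith
    have h2 := (hmem _).1 hK.isIrredundantCover_coverWith
    have h3 := coverWith_ne_isMaxCyclic hH
    have h4 := coverWith_ne_isMaxCyclic hK
    -- One of the two covers is the maximal cyclic one, so `coverWith H` and `coverWith K` are both
    -- the other.
    grind
  · rintro ⟨H, hH, huniq⟩
    have hG : ¬ IsCyclic G := fun h => hH.2.1 inferInstance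
    refine ⟨coverWith H, {C | IsMaxCyclic C}, coverWith_ne_isMaxCyclic hH, ?_⟩
    ext 𝒞
    simp only [Set.mem_ofPred_eq, Set.mem_insert_iff, Set.mem_singleton_iff]
    constructor
    · intro h𝒞
      by_cases hmem : H ∈ 𝒞
      · exact Or.inl (h𝒞.eq_coverWith hH hmem huniq)
      · exact Or.inr (h𝒞.eq_isMaxCyclic fun K hK hi => hmem (huniq K hi ▸ hK))
    · rintro (rfl | rfl)
      · exact hH.isIrredundantCover_coverWith
      · exact isIrredundantCover_isMaxCyclic hG

/-! ### Maximal subgroups of `p`-groups -/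

theorem IsPGroup.index_eq_of_isCoatom {p : ℕ} [Fact p.Prime] {P : Type*} [Group P] [Finite P]
    (hP : IsPGroup p P) {M : Subgroup P} (hM : IsCoatom M) : M.index = p := by
  obtain ⟨n, hn⟩ := IsPGroup.iff_card.1 hP
  obtain ⟨k, hk⟩ := IsPGroup.iff_card.1 (hP.to_subgroup M)
  have hp := (Fact.out : p.Prime)
  have hkn : k < n := by
    rw [← Nat.pow_lt_pow_iff_right hp.one_lt, ← hn, ← hk]
    exact lt_of_le_of_ne M.card_le_card_group fun h => hM.1 (M.eq_top_of_card_eq h)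
  obtain ⟨K, hK, hMK⟩ := Sylow.exists_subgroup_card_pow_prime_le p (m := k + 1)
    (hn ▸ pow_dvd_pow p hkn) M hk k.le_succ
  have hne : M ≠ K := by
    rintro rfl
    rw [hk] at hK
    exact absurd (Nat.pow_right_injective hp.two_le hK) (by simp)
  have hKt := hM.2 K (lt_of_le_of_ne hMK hne)
  rw [hKt, Subgroup.card_top] at hK
  have h := M.card_mul_index
  rw [hK, hk, pow_succ] at h
  exact Nat.eq_of_mul_eq_mul_left (pow_pos hp.pos k) h

theorem IsPGroup.normal_of_isCoatom {p : ℕ} [Fact p.Prime] {P : Type*} [Group P] [Finite P]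
    (hP : IsPGroup p P) {M : Subgroup P} (hM : IsCoatom M) : M.Normal := by
  have := hP.isNilpotent
  exact ((Group.isNilpotent_of_finite_tfae (G := P)).out 0 2 rfl rfl).mp this M hM

theorem IsPGroup.pow_mem_of_isCoatom {p : ℕ} [Fact p.Prime] {P : Type*} [Group P] [Finite P]
    (hP : IsPGroup p P) {M : Subgroup P} (hM : IsCoatom M) (x : P) : x ^ p ∈ M := by
  have := hP.normal_of_isCoatom hM
  rw [← hP.index_eq_of_isCoatom hM]
  exact M.pow_index_mem x

theorem isCoatom_of_index_prime {G : Type*} [Group G] {M : Subgroup G} (h : M.index.Prime) :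
    IsCoatom M := by
  refine ⟨fun e => by simp [e, Nat.not_prime_one] at h, fun K hK => ?_⟩
  have h1 := Subgroup.relIndex_mul_index hK.le
  rcases (Nat.dvd_prime h).1 (Dvd.intro_left _ h1) with h2 | h2
  · exact Subgroup.index_eq_one.1 h2
  · rw [h2] at h1
    have := Nat.eq_of_mul_eq_mul_right h.pos (h1.trans (one_mul _).symm)
    exact absurd (Subgroup.relIndex_eq_one.1 this) hK.not_ge

theorem IsPGroup.mem_zpowers_pow {p : ℕ} [Fact p.Prime] {P : Type*} [Group P]
    (hP : IsPGroup p P) (x : P) {j : ℕ} (hj : ¬ p ∣ j) : x ∈ Subgroup.zpowers (x ^ j) := by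
  obtain ⟨k, hk⟩ := IsPGroup.iff_orderOf.1 hP x
  rw [mem_zpowers_pow_iff, hk, ← Nat.coprime_iff_gcd_eq_one]
  exact (((Nat.Prime.coprime_iff_not_dvd Fact.out).2 hj).pow_left k).symm

/-- If `z = d ^ j` with `p ∣ j`, then `z` is a power of `d ^ p ∈ M`. So `j` is prime to `p`, and `d`
is in turn a power of `z`. -/
theorem IsPGroup.isMaxCyclic_zpowers {p : ℕ} [Fact p.Prime] {P : Type*} [Group P] [Finite P]
    (hP : IsPGroup p P) {M : Subgroup P} (hM : IsCoatom M) {z : P} (hz : z ∉ M) :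
    IsMaxCyclic (Subgroup.zpowers z) := by
  refine ⟨isCyclic_zpowers z, fun D hD hle => ?_⟩
  obtain ⟨d, rfl⟩ := Subgroup.isCyclic_iff_exists_zpowers_eq_top D |>.1 hD
  obtain ⟨j, rfl⟩ := mem_powers_iff_mem_zpowers.2 (hle (Subgroup.mem_zpowers z))
  simp only [Subgroup.zpowers_le]
  refine hP.mem_zpowers_pow d ?_
  rintro ⟨i, rfl⟩
  exact hz (by simpa [pow_mul] using M.pow_mem (hP.pow_mem_of_isCoatom hM d) i)

/-- A `p`-group of order `p ^ 3` generated by an element `x` of order `p ^ 2` and an element `z` of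
order `p` outside of `⟨x⟩`, which commute if `p = 2`. -/
structure IsGeneratedPair (p : ℕ) {P : Type*} [Group P] (x z : P) : Prop where
  card_eq : Nat.card P = p ^ 3
  orderOf_left : orderOf x = p ^ 2
  orderOf_right : orderOf z = p
  notMem : z ∉ Subgroup.zpowers x
  commute : ¬ Odd p → Commute x z

/-! ### Structure of a `p`-group with one intermediate subgroup -/

section UniqueIntermediate

variable {p : ℕ} [Fact p.Prime] {P : Type*} [Group P] [Finite P] {H : Subgroup P}

theorem IsIntermediate.isCoatom (hH : IsIntermediate H)
    (hu : ∀ K, IsIntermediate K → K = H) : IsCoatom H := by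
  obtain h | ⟨M, hM, hHM⟩ := eq_top_or_exists_le_coatom H
  · exact absurd h hH.1
  · obtain ⟨C, hC, hCH⟩ := hH.2.2
    exact hu M ⟨hM.1, fun h => hH.2.1 (isCyclic_of_le hHM h), C, hC, hCH.trans hHM⟩ ▸ hM

theorem IsIntermediate.isCoatom_zpowers (hP : IsPGroup p P) (hH : IsIntermediate H)
    (hu : ∀ K, IsIntermediate K → K = H) {x : P} (hx : x ∉ H) :
    IsCoatom (Subgroup.zpowers x) := by
  have hG : ¬ IsCyclic P := fun h => hH.2.1 inferInstance
  have hm := hP.isMaxCyclic_zpowers (hH.isCoatom hu) hx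
  refine ⟨ne_top_of_isCyclic hG hm.1, fun D hD => ?_⟩
  by_contra hDt
  have hDc : ¬ IsCyclic D := fun h => hD.not_ge (hm.2 h hD.le)
  exact hx (hu D ⟨hDt, hDc, _, hm, hD.le⟩ ▸ hD.le (Subgroup.mem_zpowers x))

/-- For a maximal cyclic `⟨c⟩ ≤ H`, both `x` and `c * x` lie outside `H` and generate distinct
maximal subgroups. Both contain `x ^ p` and are abelian, so they centralize it, and together they
generate `P`. -/
theorem IsIntermediate.pow_mem_center (hP : IsPGroup p P) (hH : IsIntermediate H)
    (hu : ∀ K, IsIntermediate K → K = H) {x : P} (hx : x ∉ H) :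
    x ^ p ∈ Subgroup.center P := by
  obtain ⟨C, hC, hCH⟩ := hH.2.2
  obtain ⟨c, rfl⟩ := hC.exists_zpowers_eq
  have hc : c ∈ H := hCH (Subgroup.mem_zpowers c)
  have hcx : c * x ∉ H := fun h => hx ((H.mul_mem_cancel_left hc).1 h)
  have h1 := hH.isCoatom_zpowers hP hu hx
  have h2 := hH.isCoatom_zpowers hP hu hcx
  have hle1 : Subgroup.zpowers x ≤ Subgroup.centralizer {x ^ p} := by
    rw [Subgroup.zpowers_le, Subgroup.mem_centralizer_singleton_iff]
    exact (Commute.self_pow x p).eq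
  have hle2 : Subgroup.zpowers (c * x) ≤ Subgroup.centralizer {x ^ p} := by
    rw [Subgroup.zpowers_le, Subgroup.mem_centralizer_singleton_iff]
    obtain ⟨k, hk⟩ := Subgroup.mem_zpowers_iff.1 (hP.pow_mem_of_isCoatom h2 x)
    rw [← hk]
    exact (Commute.self_zpow (c * x) k).eq
  have hne : Subgroup.zpowers x ≠ Subgroup.zpowers (c * x) := by
    intro h
    have hcm : c ∈ Subgroup.zpowers x :=
      ((Subgroup.zpowers x).mul_mem_cancel_right (Subgroup.mem_zpowers x)).1
        (h ▸ Subgroup.mem_zpowers (c * x))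
    have := hC.eq_of_le (isCyclic_zpowers x) (by simpa using hcm)
    exact hx (hCH (this ▸ Subgroup.mem_zpowers x))
  have htop : Subgroup.centralizer {x ^ p} = (⊤ : Subgroup P) := by
    rw [← top_le_iff, ← h1.sup_eq_top_of_ne h2 hne]
    exact sup_le hle1 hle2
  rw [Subgroup.mem_center_iff]
  intro g
  have hg : g ∈ Subgroup.centralizer {x ^ p} := htop ▸ Subgroup.mem_top g
  exact Subgroup.mem_centralizer_singleton_iff.1 hg

theorem IsIntermediate.exists_pow_eq_one (hP : IsPGroup p P) (hH : IsIntermediate H)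
    (hu : ∀ K, IsIntermediate K → K = H) {x : P} (hx : x ∉ H) :
    ∃ z ∈ H, z ∉ Subgroup.zpowers x ∧ z ^ p = 1 := by
  obtain ⟨C, hC, hCH⟩ := hH.2.2
  obtain ⟨c, rfl⟩ := hC.exists_zpowers_eq
  have hc : c ∈ H := hCH (Subgroup.mem_zpowers c)
  have h1 := hH.isCoatom_zpowers hP hu hx
  have hxH : x ^ p ∈ H := hP.pow_mem_of_isCoatom (hH.isCoatom hu) x
  have hcx : c ∉ Subgroup.zpowers x := fun h => by
    have := hC.eq_of_le (isCyclic_zpowers x) (by simpa using h)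
    exact hx (hCH (this ▸ Subgroup.mem_zpowers x))
  obtain ⟨k, hk⟩ := mem_powers_iff_mem_zpowers.2 (hP.pow_mem_of_isCoatom h1 c)
  have hk : x ^ k = c ^ p := hk
  have hpk : p ∣ k := by
    by_contra hpk
    have hle : Subgroup.zpowers (x ^ k) ≤ H := by
      rw [Subgroup.zpowers_le, hk]
      exact H.pow_mem hc p
    exact hx (hle (hP.mem_zpowers_pow x hpk))
  obtain ⟨j, rfl⟩ := hpk
  -- Otherwise `c` and `x` have equal orders, so `⟨c⟩` is maximal and `H ≥ ⟨c⟩` is cyclic or the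
  -- whole group.
  have hpj : p ∣ j := by
    by_contra hpj
    have hxc : orderOf (x ^ p) = orderOf (c ^ p) := by
      rw [← hk, pow_mul]
      refine (Nat.Coprime.orderOf_pow ?_).symm
      obtain ⟨k, hk⟩ := IsPGroup.iff_orderOf.1 hP (x ^ p)
      rw [hk]
      exact ((Nat.Prime.coprime_iff_not_dvd Fact.out).2 hpj).pow_left k
    have hor : orderOf x = orderOf c := by
      have hx1 : x ≠ 1 := fun h => hx (h ▸ H.one_mem)
      have hc1 : c ≠ 1 := fun h => hcx (h ▸ Subgroup.one_mem _)
      have hp0 := (Fact.out : p.Prime).ne_zero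
      rw [orderOf_pow_of_dvd hp0 (hP.dvd_orderOf hx1),
        orderOf_pow_of_dvd hp0 (hP.dvd_orderOf hc1)] at hxc
      rw [← Nat.div_mul_cancel (hP.dvd_orderOf hx1), hxc, Nat.div_mul_cancel (hP.dvd_orderOf hc1)]
    have hci : (Subgroup.zpowers c).index = p := by
      have e1 := (Subgroup.zpowers c).card_mul_index
      rw [← (Subgroup.zpowers x).card_mul_index, Nat.card_zpowers, Nat.card_zpowers, hor,
        hP.index_eq_of_isCoatom h1] at e1
      exact Nat.eq_of_mul_eq_mul_left (orderOf_pos c) e1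
    have hco : IsCoatom (Subgroup.zpowers c) :=
      isCoatom_of_index_prime (hci ▸ (Fact.out : p.Prime))
    rcases hCH.eq_or_lt with h | h
    · exact hH.2.1 (h ▸ isCyclic_zpowers c)
    · exact hH.1 (hco.2 H h)
  obtain ⟨i, rfl⟩ := hpj
  have hcomm : Commute c ((x ^ p) ^ i)⁻¹ :=
    Commute.inv_right (Commute.pow_right
      (Subgroup.mem_center_iff.1 (hH.pow_mem_center hP hu hx) c) i)
  -- Since `x ^ p` is central and `c ^ p = x ^ (p * (p * i))`, this correction of `c` has trivial
  -- `p`-th power.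
  refine ⟨c * ((x ^ p) ^ i)⁻¹, H.mul_mem hc (H.inv_mem (H.pow_mem hxH i)), fun h => hcx ?_, ?_⟩
  · refine ((Subgroup.zpowers x).mul_mem_cancel_right ?_).1 h
    exact Subgroup.inv_mem _ (Subgroup.pow_mem _ (Subgroup.pow_mem _ (Subgroup.mem_zpowers x) _) _)
  · rw [hcomm.mul_pow, ← hk, inv_pow, ← pow_mul, ← pow_mul, mul_comm i p, mul_inv_cancel]

/-- Lying outside the maximal subgroup `⟨x⟩`, the element `z` generates a maximal cyclic subgroup of
order only `p`. A subgroup of `H` of order `p ^ 2` containing `z` is therefore intermediate, so it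
is `H`. -/
theorem IsIntermediate.card_eq (hP : IsPGroup p P) (hH : IsIntermediate H)
    (hu : ∀ K, IsIntermediate K → K = H) : Nat.card H = p ^ 2 := by
  have hp := (Fact.out : p.Prime)
  obtain ⟨x, hx⟩ : ∃ x, x ∉ H := by
    by_contra! h
    exact hH.1 (H.eq_top_iff'.2 h)
  obtain ⟨z, hzH, hzx, hzp⟩ := hH.exists_pow_eq_one hP hu hx
  have hm := hP.isMaxCyclic_zpowers (hH.isCoatom_zpowers hP hu hx) hzx
  have hz1 : z ≠ 1 := fun h => hzx (h ▸ Subgroup.one_mem _)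
  have hoz : orderOf z = p := orderOf_eq_prime hzp hz1
  obtain ⟨n, hn⟩ := IsPGroup.iff_card.1 (hP.to_subgroup H)
  have hn2 : 2 ≤ n := by
    by_contra! h
    interval_cases n
    · exact hH.2.1 (isCyclic_of_card_dvd_prime (p := p) (by simp [hn]))
    · exact hH.2.1 (isCyclic_of_prime_card (p := p) (by simpa using hn))
  obtain ⟨K, hK, hle⟩ := Sylow.exists_subgroup_card_pow_prime_le p (m := 2) (n := 1)
    (hn ▸ pow_dvd_pow p hn2) (Subgroup.zpowers (⟨z, hzH⟩ : H)) (by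
      rw [Nat.card_zpowers, Subgroup.orderOf_mk, hoz, pow_one]) one_le_two
  have hKc : Nat.card (K.map H.subtype) = p ^ 2 := by
    rw [← hK]
    exact Subgroup.card_map_of_injective H.subtype_injective
  have hzK : z ∈ K.map H.subtype :=
    ⟨⟨z, hzH⟩, hle (Subgroup.mem_zpowers _), rfl⟩
  rw [← hu (K.map H.subtype) ⟨?_, ?_, _, hm, by simpa using hzK⟩, hKc]
  · intro h
    exact hH.1 (top_le_iff.1 (h ▸ Subgroup.map_subtype_le K))
  · intro h
    have := hm.eq_of_le h (by simpa using hzK)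
    rw [← this, Nat.card_zpowers, hoz] at hKc
    nlinarith [hp.two_le]

theorem IsIntermediate.exists_isGeneratedPair (hP : IsPGroup p P) (hH : IsIntermediate H)
    (hu : ∀ K, IsIntermediate K → K = H) :
    ∃ x z : P, IsGeneratedPair p x z := by
  have hp := (Fact.out : p.Prime)
  obtain ⟨x, hx⟩ : ∃ x, x ∉ H := by
    by_contra! h
    exact hH.1 (H.eq_top_iff'.2 h)
  obtain ⟨z, hzH, hzx, hzp⟩ := hH.exists_pow_eq_one hP hu hx
  have hz1 : z ≠ 1 := fun h => hzx (h ▸ Subgroup.one_mem _)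
  have hcard : Nat.card P = p ^ 3 := by
    rw [← H.card_mul_index, hH.card_eq hP hu, hP.index_eq_of_isCoatom (hH.isCoatom hu), ← pow_succ]
  have horder : ∀ y, y ∉ H → orderOf y = p ^ 2 := fun y hy => by
    have h := (Subgroup.zpowers y).card_mul_index
    rw [hP.index_eq_of_isCoatom (hH.isCoatom_zpowers hP hu hy), hcard, Nat.card_zpowers,
      pow_succ p 2] at h
    exact Nat.eq_of_mul_eq_mul_right hp.pos h
  refine ⟨x, z, hcard, horder x hx, orderOf_eq_prime hzp hz1, hzx, fun hodd => ?_⟩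
  obtain rfl : p = 2 := hp.eq_two_or_odd'.resolve_right hodd
  have hxz := horder (x * z) fun h => hx ((H.mul_mem_cancel_right hzH).1 h)
  have hzz : z⁻¹ = z := inv_eq_of_mul_eq_one_right (by rw [← sq, hzp])
  have hn := hP.normal_of_isCoatom (hH.isCoatom_zpowers hP hu hx)
  obtain ⟨k, hk⟩ := mem_powers_iff_mem_zpowers.2 (hn.conj_mem x (Subgroup.mem_zpowers x) z)
  have hk : x ^ k = z * x * z⁻¹ := hk
  rw [hzz] at hk
  have hx4 : x ^ 4 = 1 := by
    have := pow_orderOf_eq_one x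
    rwa [horder x hx] at this
  rw [← pow_mod_orderOf, horder x hx] at hk
  have hk4 : k % 2 ^ 2 < 4 := Nat.mod_lt _ (by norm_num)
  have hzz' : z * z = 1 := by rw [← sq, hzp]
  have hxx : x * x ≠ 1 := fun h => by
    have := orderOf_dvd_of_pow_eq_one (x := x) (n := 2) (by rw [sq, h])
    rw [horder x hx] at this
    norm_num at this
  have hxx' : x * z * (x * z) ≠ 1 := fun h => by
    have := orderOf_dvd_of_pow_eq_one (x := x * z) (n := 2) (by rw [sq, h])
    rw [hxz] at this
    norm_num at this
  have hconj : x = z * (z * x * z) * z := by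
    simp [mul_assoc, hzz', ← mul_assoc z z]
  generalize k % 2 ^ 2 = j at hk hk4
  -- Here `z * x * z = x ^ j`. The case `j = 0` gives `x = 1`, `j = 2` gives `x ^ 2 = 1`, and `j =
  -- 3` (dihedral) gives `(x * z) ^ 2 = 1`, although `x * z ∉ H` has order 4.
  interval_cases j
  · rw [← hk] at hconj
    simp [hzz'] at hconj
    simp [hconj] at hxx
  · rw [pow_one] at hk
    have : x * z = z * x * z * z := by rw [← hk]
    rwa [mul_assoc (z * x), hzz', mul_one] at this
  · exfalso
    apply hxx
    have : (z * x * z) * (z * x * z) = 1 := by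
      rw [← hk, ← pow_add, hx4]
    have h2 : z * (x * x) * z = 1 := by
      rw [← this]
      simp only [mul_assoc]
      rw [← mul_assoc z z, hzz', one_mul]
    have h3 : x * x = z * (z * (x * x) * z) * z := by
      simp only [mul_assoc]
      rw [hzz', mul_one, ← mul_assoc z z, hzz', one_mul]
    rw [h3, h2, mul_one, hzz']
  · exfalso
    apply hxx'
    rw [mul_assoc, ← mul_assoc z, ← hk, ← pow_succ', hx4]

end UniqueIntermediate

/-! ### From generators to the list, and a criterion for the converse -/

theorem IsGeneratedPair.isListedPGroup {p : ℕ} [Fact p.Prime] {P : Type*} [Group P] [Finite P]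
    {x z : P} (h : IsGeneratedPair p x z) : IsListedPGroup p P := by
  have hp := (Fact.out : p.Prime)
  have hP : IsPGroup p P := IsPGroup.of_card h.card_eq
  have hM : IsCoatom (Subgroup.zpowers x) := by
    apply isCoatom_of_index_prime
    have h1 := (Subgroup.zpowers x).card_mul_index
    rw [h.card_eq, Nat.card_zpowers, h.orderOf_left, pow_succ p 2] at h1
    rwa [Nat.eq_of_mul_eq_mul_left (pow_pos hp.pos 2) h1]
  have hn := hP.normal_of_isCoatom hM
  have hcz : Nat.card (Subgroup.zpowers z) = p := by rw [Nat.card_zpowers, h.orderOf_right]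
  have hcx : Nat.card (Subgroup.zpowers x) = p ^ 2 := by rw [Nat.card_zpowers, h.orderOf_left]
  have hc : Subgroup.IsComplement' (Subgroup.zpowers x) (Subgroup.zpowers z) := by
    refine Subgroup.isComplement'_of_card_mul_and_disjoint ?_ ?_
    · rw [hcx, hcz, h.card_eq, ← pow_succ]
    · rw [disjoint_iff]
      have hle : Subgroup.zpowers x ⊓ Subgroup.zpowers z ≤ Subgroup.zpowers z := inf_le_right
      have hd := Subgroup.card_dvd_of_le hle
      rw [hcz, Nat.dvd_prime hp] at hd
      refine Subgroup.eq_bot_of_card_eq _ (hd.resolve_right fun hd => h.notMem ?_)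
      have := Subgroup.eq_of_le_of_card_ge hle (by rw [hd, hcz])
      exact inf_le_left (a := Subgroup.zpowers x) (this ▸ Subgroup.mem_zpowers z)
  let e := SemidirectProduct.mulEquivSubgroup hc
  have ex : Subgroup.zpowers x ≃* Multiplicative (ZMod (p ^ 2)) :=
    (hcx ▸ zmodCyclicMulEquiv (isCyclic_zpowers x)).symm
  have ez : Subgroup.zpowers z ≃* Multiplicative (ZMod p) :=
    (hcz ▸ zmodCyclicMulEquiv (isCyclic_zpowers z)).symm
  by_cases hodd : Odd p
  · exact Or.inl ⟨hodd, _, ⟨e.symm.trans (SemidirectProduct.congr' ex ez)⟩⟩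
  · obtain rfl : p = 2 := hp.eq_two_or_odd'.resolve_right hodd
    refine Or.inr ⟨rfl, ?_⟩
    have hφ : (Subgroup.zpowers x).normalizerMonoidHom.comp (Subgroup.inclusion
        ((Subgroup.zpowers x).normalizer_eq_top ▸ le_top)) =
        (1 : Subgroup.zpowers z →* MulAut (Subgroup.zpowers x)) := by
      ext ⟨b, hb⟩ ⟨a, ha⟩
      obtain ⟨i, rfl⟩ := Subgroup.mem_zpowers_iff.1 ha
      obtain ⟨j, rfl⟩ := Subgroup.mem_zpowers_iff.1 hb
      have := ((h.commute hodd).zpow_zpow i j).eq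
      simp [← this]
    rw [hφ] at e
    exact ⟨e.symm.trans (SemidirectProduct.mulEquivProd.trans (MulEquiv.prodCongr ex ez))⟩

/-- Proper subgroups have order at most `p ^ 2`, noncyclic ones at least `p ^ 2`. A proper subgroup
containing some `x ∉ H` is thus `⟨x⟩`, so every proper noncyclic subgroup lies in `H` and equals it.
-/
theorem existsUnique_isIntermediate {p : ℕ} [Fact p.Prime] {P : Type*} [Group P] [Finite P]
    (hcard : Nat.card P = p ^ 3) {H : Subgroup P} (hH : H ≠ ⊤) (hHc : ¬ IsCyclic H)
    (hpow : ∀ x, x ∉ H → x ^ p ≠ 1) : ∃! K : Subgroup P, IsIntermediate K := by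
  have hp := (Fact.out : p.Prime)
  have hP : IsPGroup p P := IsPGroup.of_card hcard
  have hle2 : ∀ K : Subgroup P, K ≠ ⊤ → Nat.card K ≤ p ^ 2 := fun K hK => by
    obtain ⟨k, hk3, hk⟩ := (Nat.dvd_prime_pow hp).1 (hcard ▸ K.card_subgroup_dvd_card)
    rw [hk]
    refine Nat.pow_le_pow_right hp.pos ?_
    by_contra! h
    obtain rfl : k = 3 := by omega
    exact hK (K.eq_top_of_card_eq (hk.trans hcard.symm))
  have hge2 : ∀ K : Subgroup P, ¬ IsCyclic K → p ^ 2 ≤ Nat.card K := fun K hK => by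
    obtain ⟨k, hk⟩ := IsPGroup.iff_card.1 (hP.to_subgroup K)
    rw [hk]
    refine Nat.pow_le_pow_right hp.pos ?_
    by_contra! h
    exact hK (isCyclic_of_card_dvd_prime (p := p) (hk ▸ pow_dvd_pow p (by omega : k ≤ 1) |>.trans
      (pow_one p).dvd))
  have horder : ∀ x, x ∉ H → p ^ 2 ≤ orderOf x := fun x hx => by
    obtain ⟨k, hk⟩ := IsPGroup.iff_orderOf.1 hP x
    rw [hk]
    refine Nat.pow_le_pow_right hp.pos ?_
    by_contra! h
    refine hpow x hx (orderOf_dvd_iff_pow_eq_one.1 ?_)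
    exact hk ▸ pow_dvd_pow p (by omega : k ≤ 1) |>.trans (pow_one p).dvd
  have hPc : ¬ IsCyclic P := fun h => hHc inferInstance
  refine ⟨H, ⟨hH, hHc, ?_⟩, fun K hK => ?_⟩
  · obtain ⟨x, hx⟩ : ∃ x, x ∉ H := by
      by_contra! h
      exact hH (H.eq_top_iff'.2 h)
    have hcx : Nat.card (Subgroup.zpowers x) = p ^ 2 :=
      le_antisymm (hle2 _ (ne_top_of_isCyclic hPc (isCyclic_zpowers x)))
        (Nat.card_zpowers x ▸ horder x hx)
    have hM : IsCoatom (Subgroup.zpowers x) := by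
      apply isCoatom_of_index_prime
      have h1 := (Subgroup.zpowers x).card_mul_index
      rw [hcard, hcx, pow_succ p 2] at h1
      rwa [Nat.eq_of_mul_eq_mul_left (pow_pos hp.pos 2) h1]
    obtain ⟨z, hzH, hzx⟩ := SetLike.not_le_iff_exists.1
      fun h : H ≤ Subgroup.zpowers x => hHc (isCyclic_of_le h (isCyclic_zpowers x))
    exact ⟨_, hP.isMaxCyclic_zpowers hM hzx, by simpa using hzH⟩
  · have hKH : K ≤ H := fun x hxK => by
      by_contra hx
      have := Subgroup.eq_of_le_of_card_ge (H := Subgroup.zpowers x) (K := K) (by simpa using hxK)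
        ((hle2 K hK.1).trans (Nat.card_zpowers x ▸ horder x hx))
      exact hK.2.1 (this ▸ isCyclic_zpowers x)
    exact Subgroup.eq_of_le_of_card_ge hKH ((hle2 H hH).trans (hge2 K hK.2.1))

/-! ### Powers in semidirect products -/

theorem MulAut.apply_pow_of_zpow {N K : Type*} [CommGroup N] [Group K] {φ : K →* MulAut N}
    {k : K} {a : ℤ} (ha : ∀ n, φ k n = n ^ a) (j : ℕ) (n : N) : φ (k ^ j) n = n ^ a ^ j := by
  induction j generalizing n with
  | zero => simp
  | succ j ih => rw [pow_succ, map_mul, MulAut.mul_apply, ha, ih, ← zpow_mul, pow_succ']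

theorem SemidirectProduct.right_pow {N K : Type*} [Group N] [Group K] {φ : K →* MulAut N}
    (g : N ⋊[φ] K) (j : ℕ) : (g ^ j).right = g.right ^ j :=
  map_pow (SemidirectProduct.rightHom (φ := φ)) g j

theorem SemidirectProduct.left_pow_of_zpow {N K : Type*} [CommGroup N] [Group K]
    {φ : K →* MulAut N} (g : N ⋊[φ] K) {a : ℤ} (ha : ∀ n, φ g.right n = n ^ a) (j : ℕ) :
    (g ^ j).left = g.left ^ (∑ i ∈ Finset.range j, a ^ i) := by
  induction j with
  | zero => simp
  | succ j ih =>
    rw [pow_succ, SemidirectProduct.mul_left, ih, SemidirectProduct.right_pow,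
      MulAut.apply_pow_of_zpow ha, Finset.sum_range_succ, zpow_add]

section SemidirectProduct

variable {p : ℕ} [Fact p.Prime] {N K : Type*} [CommGroup N] [Group K] [IsCyclic N]
  {φ : K →* MulAut N}

/-- By `hφ`, the elements with `g.left ^ p = 1` are exactly those with `g ^ p = 1`. They form a
subgroup because automorphisms of the abelian group `N` preserve its `p`-torsion. -/
theorem existsUnique_isIntermediate_semidirectProduct [Finite N] [Finite K]
    (hcN : Nat.card N = p ^ 2) (hcK : Nat.card K = p)
    (hφ : ∀ g : N ⋊[φ] K, (g ^ p).left = g.left ^ p) :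
    ∃! H : Subgroup (N ⋊[φ] K), IsIntermediate H := by
  have hp := (Fact.out : p.Prime)
  have hfin : Finite (N ⋊[φ] K) := Finite.of_equiv _ SemidirectProduct.equivProd.symm
  have hcS : Nat.card (N ⋊[φ] K) = p ^ 3 := by
    rw [SemidirectProduct.card, hcN, hcK, ← pow_succ]
  obtain ⟨n, hn⟩ := IsCyclic.exists_ofOrder_eq_natCard (α := N)
  rw [hcN] at hn
  let H : Subgroup (N ⋊[φ] K) :=
    { carrier := {g | g.left ^ p = 1}
      one_mem' := one_pow p
      mul_mem' := fun {a b} (ha : a.left ^ p = 1) (hb : b.left ^ p = 1) => by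
        change (a.left * φ a.right b.left) ^ p = 1
        rw [mul_pow, ← map_pow, ha, hb, map_one, mul_one]
      inv_mem' := fun {a} (ha : a.left ^ p = 1) => by
        change (φ a.right⁻¹ a.left⁻¹) ^ p = 1
        rw [← map_pow, inv_pow, ha, inv_one, map_one] }
  have hmem : ∀ g, g ∈ H ↔ g.left ^ p = 1 := fun g => Iff.rfl
  have hHp : ∀ g ∈ H, g ^ p = 1 := fun g hg => by
    refine SemidirectProduct.ext ((hφ g).trans hg) ?_
    rw [SemidirectProduct.right_pow, ← hcK, pow_card_eq_one', SemidirectProduct.one_right]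
  refine existsUnique_isIntermediate hcS (H := H) (fun h => ?_) (fun h => ?_) fun x hx h1 => ?_
  · have : SemidirectProduct.inl n ∈ H := h ▸ Subgroup.mem_top _
    have := orderOf_dvd_of_pow_eq_one ((hmem _).1 this)
    rw [SemidirectProduct.left_inl, hn] at this
    have := Nat.le_of_dvd hp.pos this
    nlinarith [hp.two_le]
  -- A cyclic `H` has order at most `p`, so it is the copy of `K`; but it also contains `n ^ p ≠ 1`
  -- from `N`.
  · obtain ⟨g, hg⟩ := Subgroup.isCyclic_iff_exists_zpowers_eq_top H |>.1 h
    have hgH : g ∈ H := hg ▸ Subgroup.mem_zpowers g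
    have hcard : Nat.card H ≤ p := by
      rw [← hg, Nat.card_zpowers]
      exact Nat.le_of_dvd hp.pos (orderOf_dvd_of_pow_eq_one (hHp g hgH))
    have hle : (SemidirectProduct.inr : K →* N ⋊[φ] K).range ≤ H := by
      rintro _ ⟨k, rfl⟩
      simp [hmem]
    have hcr : Nat.card (SemidirectProduct.inr : K →* N ⋊[φ] K).range = p := by
      rw [← hcK]
      exact (Nat.card_congr
        (MonoidHom.ofInjective SemidirectProduct.inr_injective).toEquiv).symm
    have heq := Subgroup.eq_of_le_of_card_ge hle (hcard.trans hcr.ge)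
    have hnp : SemidirectProduct.inl (n ^ p) ∈ H := by
      rw [hmem, SemidirectProduct.left_inl, ← pow_mul, ← sq, ← hn, pow_orderOf_eq_one]
    rw [← heq] at hnp
    obtain ⟨k, hk⟩ := hnp
    have hk := congrArg SemidirectProduct.left hk
    rw [SemidirectProduct.left_inr, SemidirectProduct.left_inl] at hk
    have := Nat.le_of_dvd hp.pos (orderOf_dvd_of_pow_eq_one hk.symm)
    rw [hn] at this
    nlinarith [hp.two_le]
  · exact hx ((hmem x).2 ((hφ x).symm.trans (by rw [h1, SemidirectProduct.one_left])))

/-- The action is `n ↦ n ^ a` with `a ^ p ≡ 1` modulo `p ^ 2`, so `a ≡ 1` modulo `p` by Fermat. For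
odd `p` this gives `1 + a + ⋯ + a ^ (p - 1) ≡ p` modulo `p ^ 2`. For `p = 2` it fails at `a = -1`.
-/
theorem SemidirectProduct.left_pow_eq_of_odd (hodd : Odd p) (hcN : Nat.card N = p ^ 2)
    (hcK : Nat.card K = p) (g : N ⋊[φ] K) : (g ^ p).left = g.left ^ p := by
  obtain ⟨n, hn⟩ := IsCyclic.exists_ofOrder_eq_natCard (α := N)
  rw [hcN] at hn
  obtain ⟨a, ha⟩ := MonoidHom.map_cyclic (φ g.right).toMonoidHom
  have ha : ∀ n, φ g.right n = n ^ a := ha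
  have h1 : n ^ a ^ p = n := by
    rw [← MulAut.apply_pow_of_zpow ha, ← hcK, pow_card_eq_one', map_one, MulAut.one_apply]
  have h2 : ((p ^ 2 : ℕ) : ℤ) ∣ a ^ p - 1 := by
    rw [← hn, orderOf_dvd_iff_zpow_eq_one, zpow_sub, h1, zpow_one, mul_inv_cancel]
  have h3 : (p : ℤ) ∣ a - 1 := by
    have h4 : (p : ℤ) ∣ a ^ p - 1 := (by exact_mod_cast Dvd.intro_left p (sq p).symm :
      (p : ℤ) ∣ ((p ^ 2 : ℕ) : ℤ)).trans h2
    rw [← ZMod.intCast_zmod_eq_zero_iff_dvd] at h4 ⊢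
    push_cast at h4 ⊢
    rwa [ZMod.pow_card] at h4
  obtain ⟨b, hb⟩ := h3
  have hS : ((p ^ 2 : ℕ) : ℤ) ∣ ∑ i ∈ Finset.range p, a ^ i - p := by
    rw [show a = 1 + p * b by linarith]
    simpa using odd_sq_dvd_geom_sum₂_sub (a := (1 : ℤ)) (b := b) hodd
  obtain ⟨c, hc⟩ := hS
  rw [SemidirectProduct.left_pow_of_zpow g ha, show ∑ i ∈ Finset.range p, a ^ i =
    p + ((p ^ 2 : ℕ) : ℤ) * c by linarith, zpow_add, zpow_mul, zpow_natCast, zpow_natCast,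
    ← hcN, pow_card_eq_one', one_zpow, mul_one]

end SemidirectProduct

/-! ### Invariance under isomorphism -/

section Transport

variable {G G' : Type*} [Group G] [Group G']

theorem isCyclic_mapSubgroup_iff (e : G ≃* G') {H : Subgroup G} :
    IsCyclic (e.mapSubgroup H) ↔ IsCyclic H :=
  (e.subgroupMap H).symm.isCyclic

theorem IsMaxCyclic.mapSubgroup {C : Subgroup G} (hC : IsMaxCyclic C) (e : G ≃* G') :
    IsMaxCyclic (e.mapSubgroup C) := by
  refine ⟨(isCyclic_mapSubgroup_iff e).2 hC.1, fun D hD hle => ?_⟩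
  obtain ⟨D, rfl⟩ := e.mapSubgroup.surjective D
  exact e.mapSubgroup.monotone
    (hC.2 ((isCyclic_mapSubgroup_iff e).1 hD) (e.mapSubgroup.le_iff_le.1 hle))

theorem IsIntermediate.mapSubgroup {H : Subgroup G} (hH : IsIntermediate H) (e : G ≃* G') :
    IsIntermediate (e.mapSubgroup H) := by
  obtain ⟨h1, h2, C, hC, hCH⟩ := hH
  refine ⟨fun h => h1 ?_, fun h => h2 ((isCyclic_mapSubgroup_iff e).1 h), _, hC.mapSubgroup e,
    e.mapSubgroup.monotone hCH⟩
  exact e.mapSubgroup.injective (h.trans (map_top e.mapSubgroup).symm)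

theorem existsUnique_isIntermediate_of_mulEquiv (e : G ≃* G')
    (h : ∃! H : Subgroup G, IsIntermediate H) : ∃! H : Subgroup G', IsIntermediate H := by
  obtain ⟨H, hH, hu⟩ := h
  refine ⟨_, hH.mapSubgroup e, fun K hK => ?_⟩
  have := hu _ (hK.mapSubgroup e.symm)
  exact (e.mapSubgroup.apply_symm_apply K).symm.trans (congrArg e.mapSubgroup this)

end Transport

theorem IsListedPGroup.existsUnique_isIntermediate {p : ℕ} [Fact p.Prime] {P : Type*} [Group P]
    (h : IsListedPGroup p P) : ∃! H : Subgroup P, IsIntermediate H := by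
  have : NeZero (p ^ 2) := ⟨pow_ne_zero 2 (Fact.out : p.Prime).ne_zero⟩
  have hcN : Nat.card (Multiplicative (ZMod (p ^ 2))) = p ^ 2 := by simp
  have hcK : Nat.card (Multiplicative (ZMod p)) = p := by simp
  rcases h with ⟨hodd, φ, ⟨e⟩⟩ | ⟨rfl, ⟨e⟩⟩
  · exact existsUnique_isIntermediate_of_mulEquiv e.symm
      (existsUnique_isIntermediate_semidirectProduct hcN hcK
        (SemidirectProduct.left_pow_eq_of_odd hodd hcN hcK))
  · refine existsUnique_isIntermediate_of_mulEquiv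
      ((SemidirectProduct.mulEquivProd (N := Multiplicative (ZMod (2 ^ 2)))
        (G := Multiplicative (ZMod 2))).trans e.symm)
      (existsUnique_isIntermediate_semidirectProduct hcN hcK fun g => ?_)
    rw [SemidirectProduct.left_pow_of_zpow g (a := 1) (by simp)]
    simp

theorem IsPGroup.coverBeta_eq_two_iff {p : ℕ} [Fact p.Prime] {P : Type*} [Group P] [Finite P]
    (hP : IsPGroup p P) : coverBeta P = 2 ↔ IsListedPGroup p P := by
  rw [_root_.coverBeta_eq_two_iff]
  refine ⟨fun ⟨H, hH, hu⟩ => ?_, fun h => h.existsUnique_isIntermediate⟩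
  obtain ⟨x, z, h⟩ := IsIntermediate.exists_isGeneratedPair hP hH hu
  exact h.isListedPGroup

/-! ### Direct products of coprime orders -/

section Prod

variable {A B : Type*} [Group A] [Group B]

theorem Subgroup.le_prod_map (D : Subgroup (A × B)) :
    D ≤ (D.map (MonoidHom.fst A B)).prod (D.map (MonoidHom.snd A B)) :=
  Subgroup.le_prod_iff.2 ⟨le_rfl, le_rfl⟩

theorem Subgroup.map_fst_prod (C : Subgroup A) (D : Subgroup B) :
    (C.prod D).map (MonoidHom.fst A B) = C := by
  ext a
  simp only [Subgroup.mem_map, Subgroup.mem_prod]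
  exact ⟨fun ⟨x, hx, h⟩ => h ▸ hx.1, fun h => ⟨(a, 1), ⟨h, D.one_mem⟩, rfl⟩⟩

theorem Subgroup.map_snd_prod (C : Subgroup A) (D : Subgroup B) :
    (C.prod D).map (MonoidHom.snd A B) = D := by
  ext a
  simp only [Subgroup.mem_map, Subgroup.mem_prod]
  exact ⟨fun ⟨x, hx, h⟩ => h ▸ hx.2, fun h => ⟨(1, a), ⟨C.one_mem, h⟩, rfl⟩⟩

theorem isCyclic_map {G G' : Type*} [Group G] [Group G'] {D : Subgroup G} (hD : IsCyclic D)
    (f : G →* G') : IsCyclic (D.map f) :=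
  isCyclic_of_surjective _ (f.subgroupMap_surjective D)

theorem isCyclic_subgroup_prod_iff (h : (Nat.card A).Coprime (Nat.card B)) {C : Subgroup A}
    {D : Subgroup B} : IsCyclic (C.prod D) ↔ IsCyclic C ∧ IsCyclic D := by
  rw [(C.prodEquiv D).isCyclic, Group.isCyclic_prod_iff]
  have := Nat.Coprime.coprime_dvd_left C.card_subgroup_dvd_card
    (Nat.Coprime.coprime_dvd_right D.card_subgroup_dvd_card h)
  tauto

theorem IsMaxCyclic.prod (h : (Nat.card A).Coprime (Nat.card B)) {C : Subgroup A}
    {D : Subgroup B} (hC : IsMaxCyclic C) (hD : IsMaxCyclic D) : IsMaxCyclic (C.prod D) := by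
  refine ⟨(isCyclic_subgroup_prod_iff h).2 ⟨hC.1, hD.1⟩, fun E hE hle => ?_⟩
  refine E.le_prod_map.trans (Subgroup.prod_mono (hC.2 (isCyclic_map hE _) ?_)
    (hD.2 (isCyclic_map hE _) ?_))
  · exact (Subgroup.map_fst_prod C D).ge.trans (Subgroup.map_mono hle)
  · exact (Subgroup.map_snd_prod C D).ge.trans (Subgroup.map_mono hle)

theorem isIntermediate_prod (h : (Nat.card A).Coprime (Nat.card B)) {C C' : Subgroup A}
    {D D' : Subgroup B} (hC : IsMaxCyclic C) (hD : IsMaxCyclic D) (hCC : C ≤ C') (hDD : D ≤ D')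
    (hne : C' ≠ ⊤ ∨ D' ≠ ⊤) (hcyc : ¬ IsCyclic C' ∨ ¬ IsCyclic D') :
    IsIntermediate (C'.prod D') := by
  refine ⟨fun ht => ?_, fun ht => ?_, _, hC.prod h hD, Subgroup.prod_mono hCC hDD⟩
  · rcases hne with hne | hne
    · exact hne (by rw [← Subgroup.map_fst_prod C' D', ht, ← MonoidHom.range_eq_map]
                    exact MonoidHom.range_eq_top.2 Prod.fst_surjective)
    · exact hne (by rw [← Subgroup.map_snd_prod C' D', ht, ← MonoidHom.range_eq_map]
                    exact MonoidHom.range_eq_top.2 Prod.snd_surjective)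
  · have := (isCyclic_subgroup_prod_iff h).1 ht
    tauto

/-- If both factors were noncyclic, `C × B` and `A × D`, with `C` and `D` maximal cyclic, would be
two intermediate subgroups. -/
theorem isCyclic_right_of_existsUnique [Finite A] [Finite B]
    (h : (Nat.card A).Coprime (Nat.card B))
    (hu : ∃! H : Subgroup (A × B), IsIntermediate H) (hA : ¬ IsCyclic A) : IsCyclic B := by
  by_contra hB
  obtain ⟨C, hC, -⟩ := exists_isMaxCyclic_mem (1 : A)
  obtain ⟨D, hD, -⟩ := exists_isMaxCyclic_mem (1 : B)
  have hCt := ne_top_of_isCyclic hA hC.1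
  have hDt := ne_top_of_isCyclic hB hD.1
  have h1 := isIntermediate_prod h hC hD le_rfl le_top (Or.inl hCt)
    (Or.inr (isCyclic_top_iff.not.2 hB))
  have h2 := isIntermediate_prod h hC hD le_top le_rfl (Or.inr hDt)
    (Or.inl (isCyclic_top_iff.not.2 hA))
  have := congrArg (Subgroup.map (MonoidHom.fst A B)) (hu.unique h1 h2)
  rw [Subgroup.map_fst_prod, Subgroup.map_fst_prod] at this
  exact hCt this

/-- As `B` is cyclic, every maximal cyclic subgroup of `A × B` has the form `C × B`. An intermediate
subgroup thus contains `1 × B` and is determined by its projection to `A`. -/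
theorem existsUnique_isIntermediate_left (h : (Nat.card A).Coprime (Nat.card B))
    (hB : IsCyclic B) (hu : ∃! H : Subgroup (A × B), IsIntermediate H) :
    ∃! H : Subgroup A, IsIntermediate H := by
  have hBm : IsMaxCyclic (⊤ : Subgroup B) := ⟨isCyclic_top_iff.2 hB, fun _ _ _ => le_top⟩
  obtain ⟨H, ⟨hHt, hHc, C, hC, hCH⟩, hu⟩ := hu
  have hCeq : C = (C.map (MonoidHom.fst A B)).prod ⊤ :=
    hC.eq_of_le ((isCyclic_subgroup_prod_iff h).2 ⟨isCyclic_map hC.1 _, hBm.1⟩)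
      (C.le_prod_map.trans (Subgroup.prod_mono le_rfl le_top))
  have hHeq : H = (H.map (MonoidHom.fst A B)).prod ⊤ := by
    refine le_antisymm (H.le_prod_map.trans (Subgroup.prod_mono le_rfl le_top)) ?_
    rintro ⟨a, b⟩ ⟨⟨⟨a', b'⟩, hab, rfl⟩, -⟩
    have hb : ((1 : A), b'⁻¹ * b) ∈ C := by
      rw [hCeq]
      exact ⟨Subgroup.one_mem _, Subgroup.mem_top _⟩
    simpa using H.mul_mem hab (hCH hb)
  refine ⟨H.map (MonoidHom.fst A B), ⟨fun ht => ?_, fun hc => ?_, C.map (MonoidHom.fst A B),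
    ⟨isCyclic_map hC.1 _, fun D hD hle => ?_⟩, Subgroup.map_mono hCH⟩, ?_⟩
  · rw [ht, Subgroup.top_prod_top] at hHeq
    exact hHt hHeq
  · rw [hHeq] at hHc
    exact hHc ((isCyclic_subgroup_prod_iff h).2 ⟨hc, hBm.1⟩)
  · have := hC.eq_of_le ((isCyclic_subgroup_prod_iff h).2 ⟨hD, hBm.1⟩)
      (hCeq.le.trans (Subgroup.prod_mono hle le_rfl))
    rw [this, Subgroup.map_fst_prod]
  · rintro K ⟨hKt, hKc, D, hD, hDK⟩
    rw [← hu _ (isIntermediate_prod h hD hBm hDK le_rfl (Or.inl hKt) (Or.inl hKc)),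
      Subgroup.map_fst_prod]

end Prod

/-! ### Nilpotent groups and the main theorem -/

theorem Sylow.exists_mulEquiv_prod.{u} {G : Type u} [Group G] [Finite G] [Group.IsNilpotent G] {p : ℕ}
    [Fact p.Prime] (P : Sylow p G) (hp : p ∣ Nat.card G) :
    ∃ (Q : Type u) (_ : Group Q), Nonempty (G ≃* P × Q) := by
  classical
  have hn : ∀ {q : ℕ} [Fact q.Prime] (S : Sylow q G), S.Normal :=
    fun {q} hq S => ((Group.isNilpotent_of_finite_tfae (G := G)).out 0 3 rfl rfl).mp ‹_› q hq S
  let p₀ : (Nat.card G).primeFactors :=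
    ⟨p, Nat.mem_primeFactors.2 ⟨Fact.out, hp, Nat.card_pos.ne'⟩⟩
  let β : (Nat.card G).primeFactors → Type _ := fun q => ∀ S : Sylow q G, S
  let e₁ : (∀ q, β q) ≃* G := Sylow.directProductOfNormal hn
  let e₂ : (∀ q, β q) ≃* β p₀ × ∀ q : { q // q ≠ p₀ }, β q :=
    { Equiv.piSplitAt p₀ β with map_mul' := fun _ _ => rfl }
  let u : Unique (Sylow p₀ G) :=
    ⟨⟨P⟩, fun S => (Sylow.unique_of_normal P (hn P)).eq_default S |>.trans
      ((Sylow.unique_of_normal P (hn P)).eq_default P).symm⟩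
  let e₃ : β p₀ ≃* P := MulEquiv.piUnique (fun S : Sylow p₀ G => S)
  exact ⟨∀ q : { q // q ≠ p₀ }, β q, inferInstance,
    ⟨(e₁.symm.trans e₂).trans (e₃.prodCongr (MulEquiv.refl _))⟩⟩

theorem exists_sylow_of_coverBeta_eq_two {G : Type*} [Group G] [Finite G] [Group.IsNilpotent G]
    (hG : coverBeta G = 2) :
    ∃ (p : ℕ) (_ : p.Prime) (P : Sylow p G) (m : ℕ),
      0 < m ∧ Nat.Coprime (Nat.card P) m ∧
      Nonempty (G ≃* P × Multiplicative (ZMod m)) ∧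
      coverBeta P = 2 ∧
      (∃ C : Subgroup P, IsCyclic C ∧ IsCoatom C) ∧
      IsListedPGroup p P := by
  rw [coverBeta_eq_two_iff] at hG
  have hGc : ¬ IsCyclic G := fun h => by
    obtain ⟨H, hH, -⟩ := hG
    exact hH.2.1 inferInstance
  obtain ⟨p, hp, P, hP⟩ : ∃ (p : ℕ) (_ : p.Prime) (P : Sylow p G), ¬ IsCyclic P := by
    by_contra! h
    -- A nilpotent group whose Sylow subgroups are all cyclic is cyclic.
    have : IsZGroup G := ⟨fun p hp P => h p hp P⟩
    exact hGc inferInstance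
  have := Fact.mk hp
  have hdvd : p ∣ Nat.card G := by
    refine (P.2.card_eq_or_dvd.resolve_left fun h => hP ?_).trans
      (Subgroup.card_subgroup_dvd_card (P : Subgroup G))
    have := (Nat.card_eq_one_iff_unique.1 h).1
    infer_instance
  obtain ⟨Q, _, ⟨e⟩⟩ := P.exists_mulEquiv_prod hdvd
  have hfin : Finite (P × Q) := Finite.of_equiv _ e.toEquiv
  have : Finite Q := Finite.of_surjective (Prod.snd : P × Q → Q) Prod.snd_surjective
  have hcard : Nat.card Q = (P : Subgroup G).index := by
    have h1 := (P : Subgroup G).card_mul_index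
    rw [Nat.card_congr e.toEquiv, Nat.card_prod] at h1
    exact (Nat.eq_of_mul_eq_mul_left Nat.card_pos h1).symm
  have hcop : (Nat.card P).Coprime (Nat.card Q) := by
    obtain ⟨n, hn⟩ := IsPGroup.iff_card.1 P.2
    rw [hcard, show Nat.card P = p ^ n from hn]
    exact ((Nat.Prime.coprime_iff_not_dvd hp).2 P.not_dvd_index).pow_left n
  have hu := existsUnique_isIntermediate_of_mulEquiv e hG
  have hQ := isCyclic_right_of_existsUnique hcop hu hP
  have huP := existsUnique_isIntermediate_left hcop hQ hu
  have hβ : coverBeta P = 2 := coverBeta_eq_two_iff.2 huP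
  refine ⟨p, hp, P, Nat.card Q, Nat.card_pos, hcop,
    ⟨e.trans ((MulEquiv.refl P).prodCongr (zmodCyclicMulEquiv hQ).symm)⟩, hβ, ?_,
    (IsPGroup.coverBeta_eq_two_iff P.2).1 hβ⟩
  obtain ⟨H, hH, hHu⟩ := huP
  obtain ⟨x, hx⟩ : ∃ x, x ∉ H := by
    by_contra! h
    exact hH.1 (H.eq_top_iff'.2 h)
  exact ⟨_, isCyclic_zpowers x, hH.isCoatom_zpowers P.2 hHu hx⟩

theorem mainTheorem2 :
    (∀ (G : Type*) [Group G] [Finite G] [Group.IsNilpotent G], coverBeta G = 2 →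
      ∃ (p : ℕ) (_ : p.Prime) (P : Sylow p G) (m : ℕ),
        0 < m ∧ Nat.Coprime (Nat.card P) m ∧
        Nonempty (G ≃* P × Multiplicative (ZMod m)) ∧
        coverBeta P = 2 ∧
        (∃ C : Subgroup P, IsCyclic C ∧ IsCoatom C) ∧
        IsListedPGroup p P) ∧
    (∀ (p : ℕ) (_ : p.Prime) (P : Type*) [Group P] [Finite P], IsPGroup p P →
      (coverBeta P = 2 ↔ IsListedPGroup p P)) := by
  refine ⟨fun G _ _ _ hG => exists_sylow_of_coverBeta_eq_two hG, fun p hp P _ _ hP => ?_⟩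
  have := Fact.mk hp
  exact hP.coverBeta_eq_two_iff
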